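/- Let $G=\mathrm{Sym}(\mathbb N)$. For a set $X$ with an action of $G$, a set $D\subseteq\mathbb N$ supports $x\in X$ if every $\pi\in G$ fixing each element of $D$ satisfies $\pi\cdot x=x$; a finite $D$ is the least support of $x$ if it supports $x$, no proper subset of $D$ supports $x$, and no other finite set has these two properties. $X$ is a nominal set if each of its elements has a least support; its nominal dimension is the supremum of the sizes of these least supports, and $X$ is orbit-finite if it has finitely many $G$-orbits. Let $A$ be an orbit-finite nominal set (the $G$-alphabet), with $G$ acting letterwise on $A^*$. A $G$-language is a function $L:A^*\to\{0,1\}$ for which $\{w : L(w)=1\}$ is closed under the action of $G$. A nominal DFA over $A$ consists of an orbit-finite nominal set $Q$ of states, an equivariant transition function $\delta:Q\times A\to Q$, an initial state $q_0$ with $G\cdot q_0=\{q_0\}$, and an equivariant set $F\subseteq Q$ of accepting states; it recognizes languages as usual. Let $\mathcal L^{\mathrm{nom}}_A(n,k)$ be the set of $G$-languages over $A$ recognized by a nominal DFA whose state set has at most $n$ orbits and nominal dimension at most $k$. For sets $\mathcal C\subseteq\mathcal H$ of functions $X\to\{0,1\}$, the (EQ+MQ)-query complexity of $\mathcal C$ with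 queries from $\mathcal H$ is the least $m\in\mathbb N$ (or $\infty$ if there is none) such that some adaptive learner identifies every target $C\in\mathcal C$ within at most $m$ queries, i.e. one of its first $m$ queries is the equivalence query $C$, whatever correct answers the oracle gives. Here a query is either an equivalence query $H\in\mathcal H$, answered by "yes" if $H=C$ and otherwise by some $x$ with $H(x)\ne C(x)$, or a membership query $x\in X$, answered by $C(x)$. **Theorem.** Fix an orbit-finite $G$-alphabet $A$. For every $c\in\mathbb N$ there is a constant $K\in\mathbb N$, depending only on $A$ and $c$, such that for all integers $n\ge 2$ and $k$ with $1\le k\le n^c$, the (EQ+MQ)-query complexity of $\mathcal L^{\mathrm{nom}}_A(n,k)$ with queries from $\mathcal L^{\mathrm{nom}}_A(n,k)$ is at most $\dfrac{n^{Kk}}{k^k}$. -/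

import Mathlib

namespace NominalLearning

universe u

/-! ### Query learning -/

/-- A query over the instance space `X`: an equivalence query submits a hypothesis, a membership
query submits an instance. -/
inductive Query (X : Type u) : Type u
  | eq (H : X → Bool)
  | mem (x : X)

/-- The answers an oracle can give. -/
inductive Answer (X : Type u) : Type u
  | yes
  | counterexample (x : X)
  | value (b : Bool)

/-- `CorrectAnswer C q a`: the oracle with target concept `C` may answer the query `q` by `a`. -/
def CorrectAnswer {X : Type u} (C : X → Bool) : Query X → Answer X → Prop
  | .eq H, .yes => H = C
  | .eq H, .counterexample x => H x ≠ C x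
  | .mem x, .value b => C x = b
  | _, _ => False

/-- A (deterministic, adaptive) learner chooses the next query from the list of all earlier queries
and their answers (oldest first). -/
abbrev Learner (X : Type u) : Type u := List (Query X × Answer X) → Query X

/-- `IsTranscript A C h`: the list `h` of queries and answers can arise when the learner `A` plays
against an oracle with target concept `C`. -/
inductive IsTranscript {X : Type u} (A : Learner X) (C : X → Bool) :
    List (Query X × Answer X) → Prop
  | nil : IsTranscript A C []
  | snoc {h : List (Query X × Answer X)} {a : Answer X} (hh : IsTranscript A C h)
      (ha : CorrectAnswer C (A h) a) : IsTranscript A C (h ++ [(A h, a)])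

/-- Every equivalence query of the learner is taken from the hypothesis class `𝓗`; membership
queries are unrestricted. -/
def Learner.UsesHypotheses {X : Type u} (A : Learner X) (𝓗 : Set (X → Bool)) : Prop :=
  ∀ h H, A h = Query.eq H → H ∈ 𝓗

/-- The learner `A` identifies `C` within `m` queries: whatever correct answers the oracle gives,
one of the first `m` queries is the equivalence query submitting `C` itself. -/
def Learner.IdentifiesWithin {X : Type u} (A : Learner X) (C : X → Bool) (m : ℕ) : Prop :=
  ∀ h, IsTranscript A C h → h.length = m → ∃ e ∈ h, e.1 = Query.eq C

/-- The (EQ+MQ)-query complexity of the concept class `𝓒` with queries from `𝓗`: the least `m` such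
that some learner, submitting only hypotheses from `𝓗`, identifies every `C ∈ 𝓒` within `m`
queries; `⊤` if there is no such `m`. -/
noncomputable def queryComplexity {X : Type u} (𝓒 𝓗 : Set (X → Bool)) : ℕ∞ :=
  ⨅ (m : ℕ) (_ : ∃ A : Learner X, A.UsesHypotheses 𝓗 ∧ ∀ C ∈ 𝓒, A.IdentifiesWithin C m), (m : ℕ∞)

/-! ### Nominal sets for the equality symmetry -/

/-- The group `Sym(ℕ)`. -/
abbrev G : Type := Equiv.Perm ℕ

/-- The finite set `D` supports `x`, and no proper subset of `D` does. -/
def IsMinimalSupport {X : Type u} [MulAction G X] (D : Finset ℕ) (x : X) : Prop :=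
  MulAction.Supports G (D : Set ℕ) x ∧ ∀ E : Finset ℕ, E ⊂ D → ¬ MulAction.Supports G (E : Set ℕ) x

/-- `D` is the least support of `x`: it is the only finite minimal support of `x`. -/
def IsLeastSupport {X : Type u} [MulAction G X] (D : Finset ℕ) (x : X) : Prop :=
  IsMinimalSupport D x ∧ ∀ E : Finset ℕ, IsMinimalSupport E x → E = D

/-- A nominal set: every element has a least support. -/
def IsNominal (X : Type u) [MulAction G X] : Prop :=
  ∀ x : X, ∃ D : Finset ℕ, IsLeastSupport D x

/-- The number of orbits of `X`. -/
noncomputable def numOrbits (X : Type u) [MulAction G X] : ℕ∞ :=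
  ENat.card (MulAction.orbitRel.Quotient G X)

/-- `X` has only finitely many orbits. -/
def OrbitFinite (X : Type u) [MulAction G X] : Prop :=
  Finite (MulAction.orbitRel.Quotient G X)

/-- The nominal dimension of `X`: the supremum of the sizes of the least supports of its
elements. -/
noncomputable def nominalDim (X : Type u) [MulAction G X] : ℕ∞ :=
  ⨆ (x : X) (D : Finset ℕ) (_ : IsLeastSupport D x), (D.card : ℕ∞)

/-- A subset closed under the action. -/
def IsEquivariantSet {X : Type u} [MulAction G X] (Y : Set X) : Prop :=
  ∀ y ∈ Y, ∀ π : G, π • y ∈ Y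

/-! ### Languages and automata over a `G`-alphabet -/

/-- A `G`-language: the set of accepted words is closed under the letterwise action of `G`. -/
def IsGLanguage {A : Type u} [MulAction G A] (L : List A → Bool) : Prop :=
  ∀ w, L w = true → ∀ π : G, L (w.map (π • ·)) = true

/-- A nominal DFA over `A`. Orbit-finite nominal sets are countable, so taking the state set in the
universe of `A` is no restriction up to isomorphism. -/
structure NominalDFA (A : Type u) [MulAction G A] where
  /-- The states. -/
  Q : Type u
  /-- The action on the states. -/
  [action : MulAction G Q]
  nominal : IsNominal Q
  orbitFinite : OrbitFinite Q
  /-- The transition function, initial state and accepting states (`DFA` itself requires no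
  finiteness). -/
  toDFA : DFA A Q
  step_equivariant : ∀ (π : G) (q : Q) (a : A), toDFA.step (π • q) (π • a) = π • toDFA.step q a
  orbit_start : MulAction.orbit G toDFA.start = {toDFA.start}
  accept_equivariant : IsEquivariantSet toDFA.accept

attribute [instance] NominalDFA.action

/-- The automaton `M` recognizes `L`. -/
def NominalDFA.Recognizes {A : Type u} [MulAction G A] (M : NominalDFA A) (L : List A → Bool) :
    Prop :=
  ∀ w, w ∈ M.toDFA.accepts ↔ L w = true

/-- The class of `G`-languages over `A` recognized by a nominal DFA with at most `n` orbits and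
nominal dimension at most `k`. -/
def nominalLanguages (A : Type u) [MulAction G A] (n k : ℕ) : Set (List A → Bool) :=
  {L | IsGLanguage L ∧
    ∃ M : NominalDFA A, numOrbits M.Q ≤ n ∧ nominalDim M.Q ≤ k ∧ M.Recognizes L}

end NominalLearning

/-! The learner runs the halving algorithm. Take the majority vote `f` of the languages still
possible. If `f` lies in the class, submit it: any counterexample eliminates at least half of the
candidates. If not, `f` is refuted by a bounded set of words on which no language of the class
agrees with `f` everywhere. Asking these words in turn yields a disagreement, which again eliminates
at least half. With at most `m` test words and fewer than `2 ^ d` languages, `m * d` queries suffice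
(`queryComplexity_le_of_tests`).

The tests (`exists_tests`) come from a Myhill–Nerode argument. An equivariant `f` outside the class
has a Nerode quotient with more than `n` orbits or with an element whose least support exceeds `k`.
Either defect is visible on words of length at most `n`, whose supports have size linear in `n`. An
automaton in the class identifies states up to a permutation that matters only on at most `k` of
these names, so there are at most polynomial-to-the-`k` possibilities, each refuted by two words.

The count (`finite_nominalLanguages_and_ncard_lt`) encodes an automaton by its transitions between
orbit representatives, with only `k + p` names, where `p` bounds the supports of letters. Since `k ≤
n ^ c`, the number of tests, the exponent `d` and the factor `k ^ k` are each at most `n` to a power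
linear in `k` (`tests_mul_log_count_le`). -/

namespace NominalLearning

universe u

/-! ### Halving with membership and equivalence queries -/

section Learning

variable {X : Type u}

/-- There is a strategy submitting only hypotheses from `𝓗` that identifies every concept of `V`
within the given number of queries. -/
def WinsWithin (𝓗 : Set (X → Bool)) : ℕ → Set (X → Bool) → Prop
  -- A concept is removed when it is submitted, so success means an empty set, not a singleton.
  | 0, V => V = ∅
  | m + 1, V => ∃ q : Query X, (∀ H, q = .eq H → H ∈ 𝓗) ∧
      ∀ a, WinsWithin 𝓗 m {C ∈ V | CorrectAnswer C q a ∧ q ≠ .eq C}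

/-- The concepts of `𝓒` that are consistent with the history `h` and not yet submitted in it. -/
def versionSpace (𝓒 : Set (X → Bool)) (h : List (Query X × Answer X)) : Set (X → Bool) :=
  {C ∈ 𝓒 | ∀ e ∈ h, CorrectAnswer C e.1 e.2 ∧ e.1 ≠ .eq C}

lemma versionSpace_concat (𝓒 : Set (X → Bool)) (h : List (Query X × Answer X)) (q : Query X)
    (a : Answer X) :
    versionSpace 𝓒 (h ++ [(q, a)]) =
      {C ∈ versionSpace 𝓒 h | CorrectAnswer C q a ∧ q ≠ .eq C} := by
  ext C
  simp only [versionSpace, List.mem_append, List.mem_singleton, Set.mem_ofPred_eq]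
  constructor
  · rintro ⟨hC, h1⟩
    exact ⟨⟨hC, fun e he => h1 e (Or.inl he)⟩, h1 (q, a) (Or.inr rfl)⟩
  · rintro ⟨⟨hC, h1⟩, h2⟩
    refine ⟨hC, fun e he => ?_⟩
    rcases he with he | rfl
    · exact h1 e he
    · exact h2

lemma IsTranscript.correctAnswer {A : Learner X} {C : X → Bool} {h : List (Query X × Answer X)}
    (hh : IsTranscript A C h) : ∀ e ∈ h, CorrectAnswer C e.1 e.2 := by
  induction hh with
  | nil => simp
  | snoc hh ha ih =>
    intro e he
    rcases List.mem_append.1 he with he | he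
    · exact ih e he
    · rw [List.mem_singleton.1 he]
      exact ha

lemma WinsWithin.mono {𝓗 : Set (X → Bool)} {m : ℕ} {V W : Set (X → Bool)} (hVW : V ⊆ W)
    (h : WinsWithin 𝓗 m W) : WinsWithin 𝓗 m V := by
  induction m generalizing V W with
  | zero => exact Set.subset_eq_empty hVW h
  | succ m ih =>
    obtain ⟨q, hq, h⟩ := h
    refine ⟨q, hq, fun a => ih ?_ (h a)⟩
    rintro C ⟨hC, hC'⟩
    exact ⟨hVW hC, hC'⟩

lemma WinsWithin.succ [Nonempty X] {𝓗 : Set (X → Bool)} {m : ℕ} {V : Set (X → Bool)}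
    (h : WinsWithin 𝓗 m V) : WinsWithin 𝓗 (m + 1) V :=
  ⟨.mem (Classical.arbitrary X), by simp, fun _ => h.mono fun _ hC => hC.1⟩

lemma WinsWithin.le [Nonempty X] {𝓗 : Set (X → Bool)} {m m' : ℕ} {V : Set (X → Bool)}
    (h : WinsWithin 𝓗 m V) (hm : m ≤ m') : WinsWithin 𝓗 m' V := by
  induction hm with
  | refl => exact h
  | step _ ih => exact ih.succ

lemma winsWithin_empty [Nonempty X] (𝓗 : Set (X → Bool)) (m : ℕ) : WinsWithin 𝓗 m ∅ :=
  WinsWithin.le (m := 0) rfl (Nat.zero_le m)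

/-- The learner chooses any query that keeps the version space winnable with the remaining budget.
After `m` queries the version space is empty, and a target consistent with all answers can only have
left it by being submitted. -/
lemma queryComplexity_le_of_winsWithin [Nonempty X] {𝓒 𝓗 : Set (X → Bool)} {m : ℕ}
    (h : WinsWithin 𝓗 m 𝓒) : queryComplexity 𝓒 𝓗 ≤ m := by
  classical
  let P : List (Query X × Answer X) → Query X → Prop := fun h q =>
    (∀ H, q = .eq H → H ∈ 𝓗) ∧
      ∀ a, WinsWithin 𝓗 (m - (h.length + 1)) (versionSpace 𝓒 (h ++ [(q, a)]))
  let A : Learner X := fun h =>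
    if hq : ∃ q, P h q then hq.choose else .mem (Classical.arbitrary X)
  have hA : ∀ h, (∃ q, P h q) → P h (A h) := fun h hq => by
    simp only [A, dif_pos hq]
    exact hq.choose_spec
  refine iInf₂_le m ⟨A, ?_, ?_⟩
  · intro h H hH
    by_cases hq : ∃ q, P h q
    · exact (hA h hq).1 H hH
    · simp [A, dif_neg hq] at hH
  · intro C hC
    have key : ∀ h, IsTranscript A C h → h.length ≤ m →
        WinsWithin 𝓗 (m - h.length) (versionSpace 𝓒 h) := by
      intro h' hh
      induction hh with
      | nil =>
        intro _
        exact WinsWithin.mono (fun C hC => hC.1) h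
      | @snoc h a hh ha ih =>
        intro hl
        simp only [List.length_append, List.length_singleton] at hl ⊢
        have h1 := ih (by omega)
        obtain ⟨r, hr⟩ : ∃ r, m - h.length = r + 1 := ⟨m - h.length - 1, by omega⟩
        rw [hr] at h1
        obtain ⟨q, hq, hq'⟩ := h1
        refine (hA h ⟨q, hq, fun a => ?_⟩).2 a
        rw [versionSpace_concat, show m - (h.length + 1) = r by omega]
        exact hq' a
    intro h hh hl
    have h1 := key h hh hl.le
    rw [hl, Nat.sub_self] at h1
    by_contra! hne
    have : C ∈ versionSpace 𝓒 h := ⟨hC, fun e he => ⟨hh.correctAnswer e he, hne e he⟩⟩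
    rw [show versionSpace 𝓒 h = ∅ from h1] at this
    exact this

/-- Testing stops at the first disagreement with `f`, so the cost `r` of continuing is paid once,
not once per test. -/
lemma winsWithin_of_tests [Nonempty X] {𝓗 : Set (X → Bool)} (f : X → Bool) {r : ℕ} (S : List X)
    (V : Set (X → Bool)) (hdis : ∀ x ∈ S, WinsWithin 𝓗 r {C ∈ V | C x ≠ f x})
    (hagr : WinsWithin 𝓗 r {C ∈ V | ∀ x ∈ S, C x = f x}) : WinsWithin 𝓗 (S.length + r) V := by
  induction S generalizing V with
  | nil => simpa using hagr
  | cons x S ih =>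
    rw [List.length_cons, Nat.add_right_comm]
    refine ⟨.mem x, by simp, fun a => ?_⟩
    cases a with
    | yes => exact (winsWithin_empty _ _).mono fun C hC => hC.2.1
    | counterexample y => exact (winsWithin_empty _ _).mono fun C hC => hC.2.1
    | value b =>
      by_cases hb : b = f x
      · refine ih _ (fun y hy => ?_) ?_
        · refine WinsWithin.mono ?_ (hdis y (List.mem_cons_of_mem _ hy))
          rintro C ⟨⟨h1, -⟩, h2⟩
          exact ⟨h1, h2⟩
        · refine WinsWithin.mono ?_ hagr
          rintro C ⟨⟨h1, h2, -⟩, h3⟩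
          refine ⟨h1, fun y hy => ?_⟩
          rcases List.mem_cons.1 hy with rfl | hy
          · exact Eq.trans h2 hb
          · exact h3 y hy
      · refine WinsWithin.le (WinsWithin.mono ?_ (hdis x List.mem_cons_self)) (Nat.le_add_left _ _)
        rintro C ⟨h1, h2, -⟩
        refine ⟨h1, ?_⟩
        rw [show C x = b from h2]
        exact hb

lemma exists_majority {V : Set (X → Bool)} (hV : V.Finite) :
    ∃ f : X → Bool, ∀ x, 2 * {C ∈ V | C x ≠ f x}.ncard ≤ V.ncard := by
  have : ∀ x, ∃ b : Bool, 2 * {C ∈ V | C x ≠ b}.ncard ≤ V.ncard := by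
    intro x
    have hsum : {C ∈ V | C x ≠ true}.ncard + {C ∈ V | C x ≠ false}.ncard = V.ncard := by
      rw [← Set.ncard_union_eq ?_ (hV.subset fun C hC => hC.1) (hV.subset fun C hC => hC.1)]
      · congr 1
        ext C
        cases h : C x <;> simp [h]
      · rw [Set.disjoint_left]
        intro C h1 h2
        cases h : C x
        · exact h2.2 h
        · exact h1.2 h
    by_cases h : 2 * {C ∈ V | C x ≠ true}.ncard ≤ V.ncard
    · exact ⟨true, h⟩
    · exact ⟨false, by omega⟩
  choose f hf using this
  exact ⟨f, hf⟩

/-- The halving algorithm: the majority vote of the version space is either a hypothesis or is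
refuted by few membership queries. -/
lemma winsWithin_of_ncard_lt [Nonempty X] {𝓒 : Set (X → Bool)} (hfin : 𝓒.Finite) {m : ℕ}
    (hm : 1 ≤ m)
    (htest : ∀ f ∉ 𝓒, ∃ S : Finset X, S.card ≤ m ∧ ∀ C ∈ 𝓒, ∃ x ∈ S, C x ≠ f x) (d : ℕ) :
    ∀ V ⊆ 𝓒, V.ncard < 2 ^ d → WinsWithin 𝓒 (m * d) V := by
  induction d with
  | zero =>
    intro V hV hc
    have : V = ∅ := (Set.ncard_eq_zero (hfin.subset hV)).1 (by simpa using hc)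
    subst this
    exact winsWithin_empty _ _
  | succ d ih =>
    intro V hV hc
    obtain ⟨f, hf⟩ := exists_majority (hfin.subset hV)
    have hdis : ∀ x, WinsWithin 𝓒 (m * d) {C ∈ V | C x ≠ f x} := fun x =>
      ih _ (fun C hC => hV hC.1) (by have := hf x; rw [pow_succ] at hc; omega)
    by_cases hfC : f ∈ 𝓒
    · refine WinsWithin.le (m := m * d + 1) ?_ (by rw [Nat.mul_succ]; omega)
      refine ⟨.eq f, fun H hH => by cases hH; exact hfC, fun a => ?_⟩
      cases a with
      | yes => exact (winsWithin_empty _ _).mono fun C hC => hC.2.2 (congrArg _ hC.2.1)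
      | counterexample x =>
        refine WinsWithin.mono ?_ (hdis x)
        rintro C ⟨h1, h2, -⟩
        exact ⟨h1, fun h => h2 h.symm⟩
      | value b => exact (winsWithin_empty _ _).mono fun C hC => hC.2.1
    -- No concept of the class agrees with `f` on all of `S`, so the agreeing branch is empty.
    · obtain ⟨S, hS, hS'⟩ := htest f hfC
      refine (winsWithin_of_tests f S.toList V (fun x _ => hdis x)
        ((winsWithin_empty _ _).mono fun C hC => ?_)).le (m := S.toList.length + m * d) ?_
      · obtain ⟨x, hx, hne⟩ := hS' C (hV hC.1)
        exact hne (hC.2 x (Finset.mem_toList.2 hx))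
      · rw [Finset.length_toList, Nat.mul_succ]
        omega

theorem queryComplexity_le_of_tests [Nonempty X] {𝓒 : Set (X → Bool)} (hfin : 𝓒.Finite) {m d : ℕ}
    (hm : 1 ≤ m) (hd : 𝓒.ncard < 2 ^ d)
    (htest : ∀ f ∉ 𝓒, ∃ S : Finset X, S.card ≤ m ∧ ∀ C ∈ 𝓒, ∃ x ∈ S, C x ≠ f x) :
    queryComplexity 𝓒 𝓒 ≤ (m * d : ℕ) :=
  queryComplexity_le_of_winsWithin (winsWithin_of_ncard_lt hfin hm htest d 𝓒 subset_rfl hd)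

end Learning

/-! ### Supports -/

section Supports

open MulAction

lemma exists_perm_extending (s : Finset ℕ) (g : ℕ → ℕ) (hg : Set.InjOn g s) :
    ∃ π : G, ∀ x ∈ s, π x = g x := by
  obtain ⟨π, hπ⟩ := Equiv.Perm.exists_extending_pair (fun x : s => (x : ℕ)) (fun x : s => g x)
    Subtype.val_injective (fun x y h => Subtype.ext (hg x.2 y.2 h))
  exact ⟨π, fun x hx => hπ ⟨x, hx⟩⟩

/-- Inject `X \ K` into `Y`, keep `K` pointwise, and extend this finite injection to a permutation.
It serves both to make names fresh and to pull them into a bounded window. -/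
lemma exists_perm_fixing_moving (K X Y : Finset ℕ) (hYK : Disjoint Y K)
    (hc : (X \ K).card ≤ Y.card) :
    ∃ σ : G, (∀ x ∈ K, σ x = x) ∧ ∀ x ∈ X, x ∉ K → σ x ∈ Y := by
  obtain ⟨e, he, he'⟩ : ∃ e : ℕ → ℕ, (∀ x ∈ X \ K, e x ∈ Y) ∧ Set.InjOn e (X \ K : Finset ℕ) := by
    obtain ⟨e, he, he'⟩ := (Finset.finite_toSet (X \ K)).exists_injOn_of_encard_le
      (t := (Y : Set ℕ)) (by simpa only [Set.encard_coe_eq_coe_finsetCard, Nat.cast_le] using hc)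
    exact ⟨e, he, he'⟩
  obtain ⟨σ, hσ⟩ := exists_perm_extending (K ∪ X) (fun x => if x ∈ K then x else e x) (by
    have hmem : ∀ x ∈ (K ∪ X : Finset ℕ), x ∉ K → x ∈ X \ K := fun x hx hxK => by
      simp only [Finset.mem_union] at hx
      exact Finset.mem_sdiff.2 ⟨hx.resolve_left hxK, hxK⟩
    intro x hx y hy hxy
    by_cases hxK : x ∈ K <;> by_cases hyK : y ∈ K <;> simp only [hxK, hyK, if_true, if_false] at hxy
    · exact hxy
    · exact absurd (hxy ▸ hxK) (Finset.disjoint_left.1 hYK (he y (hmem y hy hyK)))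
    · exact absurd (hxy ▸ hyK) (Finset.disjoint_left.1 hYK (he x (hmem x hx hxK)))
    · exact he' (hmem x hx hxK) (hmem y hy hyK) hxy)
  refine ⟨σ, fun x hx => ?_, fun x hx hxK => ?_⟩
  · rw [hσ x (Finset.mem_union_left _ hx), if_pos hx]
  · rw [hσ x (Finset.mem_union_right _ hx), if_neg hxK]
    exact he x (Finset.mem_sdiff.2 ⟨hx, hxK⟩)

variable {X : Type u} [MulAction G X] {D E : Finset ℕ} {x : X}

lemma smul_eq_smul_of_supports (h : Supports G (D : Set ℕ) x) {π ρ : G}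
    (hπ : ∀ a ∈ D, π a = ρ a) : π • x = ρ • x := by
  rw [← inv_smul_eq_iff, smul_smul]
  refine h _ fun a ha => ?_
  rw [Equiv.Perm.smul_def, Equiv.Perm.mul_apply, hπ a ha]
  exact ρ.symm_apply_apply a

lemma supports_image (h : Supports G (D : Set ℕ) x) (π : G) :
    Supports G ((D.image π : Finset ℕ) : Set ℕ) (π • x) := by
  intro ρ hρ
  rw [smul_smul]
  refine smul_eq_smul_of_supports h fun a ha => ?_
  exact hρ (Finset.mem_coe.2 (Finset.mem_image_of_mem _ ha))

/-- The intersection of two finite supports is a support. -/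
lemma supports_inter (hD : Supports G (D : Set ℕ) x) (hE : Supports G (E : Set ℕ) x) :
    Supports G ((D ∩ E : Finset ℕ) : Set ℕ) x := by
  intro π hπ
  have hπ' : ∀ a ∈ D, a ∈ E → π a = a := fun a h1 h2 =>
    hπ (Finset.mem_coe.2 (Finset.mem_inter.2 ⟨h1, h2⟩))
  -- The names in `Y` are fresh: neither they nor their images under `π` lie in `D`. Take `ρ` fixing
  -- `D` and moving `E \ D` into `Y`; then `ρ` fixes `x`, so `ρ(E)` also supports `x`. Take `τ`
  -- fixing `D` and equal to `π` on `ρ(E) \ D`. On `ρ(E) ∩ D`, which lies in `D ∩ E`, both are the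
  -- identity, so `π • x = τ • x = x`.
  obtain ⟨Y, hY, hYc⟩ := (Finset.finite_toSet (D ∪ D.image (π⁻¹ : G))).infinite_compl
    |>.exists_subset_card_eq (E \ D).card
  have hYD : ∀ y ∈ Y, y ∉ D ∧ π y ∉ D := fun y hy => by
    have h1 := hY hy
    simp only [Set.mem_compl_iff, Finset.mem_coe, Finset.mem_union, Finset.mem_image, not_or,
      not_exists, not_and] at h1
    exact ⟨h1.1, fun h => h1.2 (π y) h (by simp)⟩
  obtain ⟨ρ, hρD, hρE⟩ := exists_perm_fixing_moving D E Y
    (Finset.disjoint_left.2 fun y hy => (hYD y hy).1) hYc.ge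
  have hρx : ρ • x = x := hD _ fun a ha => hρD a ha
  obtain ⟨τ, hτ⟩ := exists_perm_extending (D ∪ E.image ρ) (fun a => if a ∈ D then a else π a) (by
    have hmem : ∀ a ∈ (D ∪ E.image ρ : Finset ℕ), a ∉ D → a ∈ Y := fun a ha haD => by
      obtain ⟨b, hb, rfl⟩ := Finset.mem_image.1 ((Finset.mem_union.1 ha).resolve_left haD)
      refine hρE b hb fun hbD => haD ?_
      rwa [hρD b hbD]
    intro a ha b hb hab
    by_cases haD : a ∈ D <;> by_cases hbD : b ∈ D <;> simp only [haD, hbD, if_true, if_false] at hab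
    · exact hab
    · exact absurd (hab ▸ haD) (hYD b (hmem b hb hbD)).2
    · exact absurd (hab ▸ hbD) (hYD a (hmem a ha haD)).2
    · exact π.injective hab)
  have hτx : τ • x = x := hD _ fun a ha => by
    rw [Equiv.Perm.smul_def, hτ a (Finset.mem_union_left _ ha), if_pos (Finset.mem_coe.1 ha)]
  have hF := supports_image hE ρ
  rw [hρx] at hF
  rw [smul_eq_smul_of_supports hF (ρ := τ) ?_, hτx]
  intro b hb
  rw [hτ b (Finset.mem_union_right _ hb)]
  split_ifs with hbD
  · obtain ⟨a, ha, rfl⟩ := Finset.mem_image.1 hb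
    have hab : ρ a = a := ρ.injective (hρD _ hbD)
    rw [hab] at hbD ⊢
    exact hπ' a hbD ha
  · rfl

/-- Shrink to a minimal support. Two minimal finite supports both equal their intersection, hence
each other. -/
lemma exists_isLeastSupport (h : Supports G (D : Set ℕ) x) : ∃ E, IsLeastSupport E x := by
  classical
  induction hn : D.card using Nat.strong_induction_on generalizing D with
  | _ n ih =>
    subst hn
    by_cases hmin : ∃ E ⊂ D, Supports G (E : Set ℕ) x
    · obtain ⟨E, hED, hE⟩ := hmin
      exact ih _ (Finset.card_lt_card hED) hE rfl
    · push Not at hmin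
      refine ⟨D, ⟨h, hmin⟩, fun E hE => ?_⟩
      have h1 := supports_inter h hE.1
      have h2 : D ∩ E = D := by
        by_contra hne
        exact hmin _ (Finset.ssubset_iff_subset_ne.2 ⟨Finset.inter_subset_left, hne⟩) h1
      have h3 : D ∩ E = E := by
        by_contra hne
        exact hE.2 _ (Finset.ssubset_iff_subset_ne.2 ⟨Finset.inter_subset_right, hne⟩) h1
      rw [← h3, h2]

lemma IsLeastSupport.subset (h : IsLeastSupport D x) (hE : Supports G (E : Set ℕ) x) : D ⊆ E := by
  by_contra hne
  refine h.1.2 (D ∩ E) (Finset.ssubset_iff_subset_ne.2 ⟨Finset.inter_subset_left, fun h => ?_⟩)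
    (supports_inter h.1.1 hE)
  exact hne (Finset.inter_eq_left.1 h)

lemma nominalDim_le_iff {k : ℕ} :
    nominalDim X ≤ k ↔ ∀ (x : X) (D : Finset ℕ), IsLeastSupport D x → D.card ≤ k := by
  simp only [nominalDim, iSup_le_iff, Nat.cast_le]

lemma exists_smul_supports_range (h : Supports G (D : Set ℕ) x) {p : ℕ} (hp : D.card ≤ p) :
    ∃ π : G, Supports G (Finset.range p : Set ℕ) (π • x) := by
  obtain ⟨σ, -, hσ⟩ := exists_perm_fixing_moving ∅ D (Finset.range p) (by simp) (by simpa using hp)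
  refine ⟨σ, (supports_image h σ).mono ?_⟩
  intro y hy
  obtain ⟨a, ha, rfl⟩ := Finset.mem_image.1 (Finset.mem_coe.1 hy)
  exact hσ a ha (Finset.notMem_empty a)

/-- Orbit representatives of an orbit-finite nominal set that are supported by a common initial
segment of `ℕ`. -/
lemma exists_orbit_representatives {A : Type u} [MulAction G A] (hA : IsNominal A)
    (hfin : OrbitFinite A) : ∃ (p : ℕ) (r : orbitRel.Quotient G A → A),
      (∀ o, Supports G (Finset.range p : Set ℕ) (r o)) ∧ ∀ a, ∃ o, ∃ π : G, a = π • r o := by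
  classical
  have : Finite (orbitRel.Quotient G A) := hfin
  have := Fintype.ofFinite (orbitRel.Quotient G A)
  choose D hD using fun o : orbitRel.Quotient G A => hA o.out
  let p := Finset.univ.sup fun o => (D o).card
  have hp : ∀ o, (D o).card ≤ p := fun o =>
    Finset.le_sup (f := fun o => (D o).card) (Finset.mem_univ o)
  choose π hπ using fun o => exists_smul_supports_range (hD o).1.1 (hp o)
  refine ⟨p, fun o => π o • o.out, hπ, fun a => ?_⟩
  obtain ⟨ρ, hρ⟩ : ∃ ρ : G, ρ • (Quotient.mk (orbitRel G A) a : orbitRel.Quotient G A).out = a := by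
    have : a ∈ orbit G (Quotient.mk (orbitRel G A) a : orbitRel.Quotient G A).out := by
      rw [← orbitRel_apply]
      exact (orbitRel G A).iseqv.symm (Quotient.mk_out (s := orbitRel G A) a)
    exact this
  exact ⟨Quotient.mk (orbitRel G A) a, ρ * (π (Quotient.mk (orbitRel G A) a))⁻¹, by simp [mul_smul, hρ]⟩

end Supports

/-! ### Words -/

section Words

open MulAction

variable {A : Type u} [MulAction G A]

/-- The letterwise action on words. -/
instance wordAction : MulAction G (List A) where
  smul π w := w.map (π • ·)
  one_smul w := by
    show w.map ((1 : G) • ·) = w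
    simp
  mul_smul π ρ w := by
    show w.map ((π * ρ) • ·) = (w.map (ρ • ·)).map (π • ·)
    simp [mul_smul]

lemma smul_word_def (π : G) (w : List A) : π • w = w.map (π • ·) := rfl

@[simp] lemma smul_append (π : G) (v w : List A) : π • (v ++ w) = π • v ++ π • w := by
  simp [smul_word_def]

@[simp] lemma smul_singleton_word (π : G) (a : A) : π • [a] = [π • a] := rfl

lemma IsGLanguage.smul_eq {L : List A → Bool} (hL : IsGLanguage L) (π : G) (w : List A) :
    L (π • w) = L w := by
  rw [Bool.eq_iff_iff]
  refine ⟨fun h => ?_, fun h => hL w h π⟩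
  have := hL _ h π⁻¹
  change L (π⁻¹ • π • w) = true at this
  rwa [inv_smul_smul] at this

lemma exists_supports_word {p : ℕ}
    (hp : ∀ a : A, ∃ D : Finset ℕ, D.card ≤ p ∧ Supports G (D : Set ℕ) a) (w : List A) :
    ∃ D : Finset ℕ, D.card ≤ w.length * p ∧ Supports G (D : Set ℕ) w := by
  induction w with
  | nil => exact ⟨∅, by simp, fun π _ => rfl⟩
  | cons a w ih =>
    obtain ⟨D, hD, hDw⟩ := ih
    obtain ⟨E, hE, hEa⟩ := hp a
    refine ⟨D ∪ E, (Finset.card_union_le _ _).trans ?_, fun π hπ => ?_⟩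
    · rw [List.length_cons, Nat.succ_mul]
      omega
    · show (π • a) :: (π • w) = a :: w
      rw [hEa π fun b hb => hπ (by simp [Finset.mem_coe.1 hb]),
        hDw π fun b hb => hπ (by simp [Finset.mem_coe.1 hb])]

end Words

open MulAction

lemma orbit_mk_eq_iff {X : Type u} [MulAction G X] {x y : X} :
    (Quotient.mk (orbitRel G X) x = Quotient.mk (orbitRel G X) y) ↔ ∃ π : G, x = π • y := by
  rw [Quotient.eq, orbitRel_apply]
  exact exists_congr fun π => eq_comm

/-! ### Runs of nominal automata -/

section Runs

variable {A : Type u} [MulAction G A] (M : NominalDFA A)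

lemma NominalDFA.smul_start (π : G) : π • M.toDFA.start = M.toDFA.start := by
  have : π • M.toDFA.start ∈ orbit G M.toDFA.start := ⟨π, rfl⟩
  rwa [M.orbit_start] at this

lemma NominalDFA.evalFrom_smul (π : G) (q : M.Q) (w : List A) :
    M.toDFA.evalFrom (π • q) (π • w) = π • M.toDFA.evalFrom q w := by
  induction w generalizing q with
  | nil => rfl
  | cons a w ih =>
    show M.toDFA.evalFrom (M.toDFA.step (π • q) (π • a)) (π • w) = _
    rw [M.step_equivariant, ih]
    rfl

lemma NominalDFA.eval_smul (π : G) (w : List A) :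
    M.toDFA.eval (π • w) = π • M.toDFA.eval w := by
  have := M.evalFrom_smul π M.toDFA.start w
  rwa [M.smul_start] at this

lemma NominalDFA.supports_eval {D : Finset ℕ} {w : List A} (h : Supports G (D : Set ℕ) w) :
    Supports G (D : Set ℕ) (M.toDFA.eval w) := fun π hπ => by
  rw [← M.eval_smul, h π hπ]

lemma NominalDFA.smul_mem_accept (π : G) (q : M.Q) :
    π • q ∈ M.toDFA.accept ↔ q ∈ M.toDFA.accept := by
  refine ⟨fun h => ?_, fun h => M.accept_equivariant q h π⟩
  simpa using M.accept_equivariant _ h π⁻¹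

lemma NominalDFA.Recognizes.append_congr {M : NominalDFA A} {L : List A → Bool}
    (hL : M.Recognizes L) {v w : List A} (h : M.toDFA.eval v = M.toDFA.eval w) (e : List A) :
    L (v ++ e) = L (w ++ e) := by
  rw [Bool.eq_iff_iff, ← hL, ← hL, DFA.mem_accepts, DFA.mem_accepts]
  simp only [DFA.eval, DFA.evalFrom_of_append] at h ⊢
  rw [h]

end Runs

/-! ### The Nerode quotient of a `G`-language -/

section Nerode

variable {A : Type u}

/-- Two words are Nerode equivalent if they have the same accepted continuations. -/
def nerodeSetoid (f : List A → Bool) : Setoid (List A) where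
  r v w := ∀ e, f (v ++ e) = f (w ++ e)
  iseqv := ⟨fun _ _ => rfl, fun h e => (h e).symm, fun h h' e => (h e).trans (h' e)⟩

variable [MulAction G A]

/-- The states of the minimal automaton of a `G`-language. -/
def Nerode (f : {f : List A → Bool // IsGLanguage f}) : Type u := Quotient (nerodeSetoid f.1)

variable (f : {f : List A → Bool // IsGLanguage f})

/-- The state reached by a word. -/
def Nerode.mk (w : List A) : Nerode f := Quotient.mk (nerodeSetoid f.1) w

lemma Nerode.mk_eq_iff {v w : List A} :
    Nerode.mk f v = Nerode.mk f w ↔ ∀ e, f.1 (v ++ e) = f.1 (w ++ e) :=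
  Quotient.eq (r := nerodeSetoid f.1)

lemma Nerode.mk_surjective : Function.Surjective (Nerode.mk f) := Quotient.mk_surjective

instance nerodeAction : MulAction G (Nerode f) where
  -- Equivariance gives `f (π • v ++ e) = f (v ++ π⁻¹ • e)`, so the action respects Nerode
  -- equivalence.
  smul π := Quotient.map (π • ·) fun v w h e => by
    have h1 := f.2.smul_eq π (v ++ π⁻¹ • e)
    have h2 := f.2.smul_eq π (w ++ π⁻¹ • e)
    rw [smul_append, smul_inv_smul] at h1 h2
    rw [h1, h2]
    exact h _
  one_smul x := by
    obtain ⟨w, rfl⟩ := Nerode.mk_surjective f x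
    exact congrArg (Nerode.mk f) (one_smul G w)
  mul_smul π ρ x := by
    obtain ⟨w, rfl⟩ := Nerode.mk_surjective f x
    exact congrArg (Nerode.mk f) (mul_smul π ρ w)

lemma Nerode.smul_mk (π : G) (w : List A) : π • Nerode.mk f w = Nerode.mk f (π • w) := rfl

lemma Nerode.mk_append_congr {v w : List A} (h : Nerode.mk f v = Nerode.mk f w) (e : List A) :
    Nerode.mk f (v ++ e) = Nerode.mk f (w ++ e) := by
  rw [Nerode.mk_eq_iff] at h ⊢
  intro e'
  simpa using h (e ++ e')

lemma Nerode.supports_mk {D : Finset ℕ} {w : List A} (h : Supports G (D : Set ℕ) w) :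
    Supports G (D : Set ℕ) (Nerode.mk f w) := fun π hπ => by
  rw [Nerode.smul_mk, h π hπ]

/-- The minimal automaton. -/
def nerodeDFA : DFA A (Nerode f) where
  step x a := Quotient.map (· ++ [a]) (fun v w h e => by simpa using h ([a] ++ e)) x
  start := Nerode.mk f []
  accept := {x | ∃ w, x = Nerode.mk f w ∧ f.1 w = true}

lemma nerodeDFA_step (w : List A) (a : A) :
    (nerodeDFA f).step (Nerode.mk f w) a = Nerode.mk f (w ++ [a]) := rfl

lemma nerodeDFA_eval (w : List A) : (nerodeDFA f).eval w = Nerode.mk f w := by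
  induction w using List.reverseRecOn with
  | nil => rfl
  | append_singleton w a ih => rw [DFA.eval_append_singleton, ih, nerodeDFA_step]

/-- Used contrapositively: an equivariant language outside the class must have a Nerode quotient
with too many orbits or too large a dimension. -/
lemma mem_nominalLanguages_of_nerode {n k : ℕ}
    (hA : ∀ w : List A, ∃ D : Finset ℕ, Supports G (D : Set ℕ) w)
    (hn : numOrbits (Nerode f) ≤ n) (hk : nominalDim (Nerode f) ≤ k) :
    f.1 ∈ nominalLanguages A n k := by
  refine ⟨f.2, ⟨Nerode f, ?_, ?_, nerodeDFA f, ?_, ?_, ?_⟩, hn, hk, ?_⟩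
  · intro x
    obtain ⟨w, rfl⟩ := Nerode.mk_surjective f x
    obtain ⟨D, hD⟩ := hA w
    exact exists_isLeastSupport (Nerode.supports_mk f hD)
  · exact ENat.card_lt_top.1 (hn.trans_lt (ENat.natCast_lt_top n))
  · intro π x a
    obtain ⟨w, rfl⟩ := Nerode.mk_surjective f x
    rw [Nerode.smul_mk, nerodeDFA_step, nerodeDFA_step, Nerode.smul_mk, smul_append,
      smul_singleton_word]
  · ext x
    simp only [Set.mem_singleton_iff]
    constructor
    · rintro ⟨π, rfl⟩
      rfl
    · rintro rfl
      exact mem_orbit_self _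
  · rintro x ⟨w, rfl, hw⟩ π
    exact ⟨π • w, rfl, by rw [f.2.smul_eq, hw]⟩
  · intro w
    rw [DFA.mem_accepts]
    show (nerodeDFA f).eval w ∈ (nerodeDFA f).accept ↔ _
    rw [nerodeDFA_eval]
    constructor
    · rintro ⟨v, hv, hfv⟩
      have := (Nerode.mk_eq_iff f).1 hv []
      simp only [List.append_nil] at this
      rw [this, hfv]
    · exact fun h => ⟨w, rfl, h⟩

/-- Either the orbits of the short words exhaust the Nerode quotient, or there are many of them. -/
lemma exists_short_words (n : ℕ) :
    (∀ w, ∃ s : List A, s.length ≤ n ∧ ∃ π : G, Nerode.mk f w = π • Nerode.mk f s) ∨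
    ∃ S : Finset (List A), n < S.card ∧ (∀ s ∈ S, s.length ≤ n) ∧
      ∀ v ∈ S, ∀ w ∈ S, v ≠ w → ∀ π : G, Nerode.mk f v ≠ π • Nerode.mk f w := by
  classical
  induction n with
  | zero =>
    refine Or.inr ⟨{[]}, by simp, by simp, fun v hv w hw hne => ?_⟩
    exact absurd ((Finset.mem_singleton.1 hv).trans (Finset.mem_singleton.1 hw).symm) hne
  | succ n ih =>
    rcases ih with ih | ⟨S, hS, hSl, hSd⟩
    · refine Or.inl fun w => ?_
      obtain ⟨s, hs, h⟩ := ih w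
      exact ⟨s, hs.trans (Nat.le_succ n), h⟩
    · by_cases hext : ∀ w : List A, w.length ≤ n + 1 →
          ∃ s : List A, s.length ≤ n ∧ ∃ π : G, Nerode.mk f w = π • Nerode.mk f s
      · refine Or.inl fun w => ?_
        suffices h : ∃ s : List A, s.length ≤ n ∧ ∃ π : G, Nerode.mk f w = π • Nerode.mk f s by
          obtain ⟨s, hs, h⟩ := h
          exact ⟨s, hs.trans (Nat.le_succ n), h⟩
        induction w using List.reverseRecOn with
        | nil => exact ⟨[], Nat.zero_le n, 1, by simp⟩
        | append_singleton w a ihw =>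
          obtain ⟨s, hs, π, hπ⟩ := ihw
          -- Once length `n + 1` gives no new orbit, none ever appears: if `w` is equivalent to `π •
          -- s`, then `w ++ [a]` is equivalent to `π • (s ++ [π⁻¹ • a])`, an extension of a short
          -- word.
          obtain ⟨t, ht, ρ, hρ⟩ := hext (s ++ [π⁻¹ • a]) (by simpa using hs)
          refine ⟨t, ht, π * ρ, ?_⟩
          rw [mul_smul, ← hρ, Nerode.smul_mk, smul_append, smul_singleton_word, smul_inv_smul]
          exact Nerode.mk_append_congr f (hπ.trans (Nerode.smul_mk f π s)) [a]
      · push Not at hext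
        obtain ⟨w, hw, hwd⟩ := hext
        have hwS : w ∉ S := fun h => hwd w (hSl w h) 1 (one_smul G _).symm
        refine Or.inr ⟨insert w S, by rw [Finset.card_insert_of_notMem hwS]; omega, ?_, ?_⟩
        · intro s hs
          rcases Finset.mem_insert.1 hs with rfl | hs
          · exact hw
          · exact (hSl s hs).trans (Nat.le_succ n)
        · intro u hu v hv hne π heq
          rcases Finset.mem_insert.1 hu with rfl | hu' <;> rcases Finset.mem_insert.1 hv with rfl | hv'
          · exact hne rfl
          · exact hwd v (hSl v hv') π heq
          · exact hwd u (hSl u hu') π⁻¹ (by rw [heq, inv_smul_smul])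
          · exact hSd u hu' v hv' hne π heq

/-- Short representatives of `n + 1` distinct orbits suffice; the number of orbits itself may be
infinite at this point. -/
lemma exists_short_words_of_lt_numOrbits {n : ℕ}
    (hshort : ∀ w, ∃ s : List A, s.length ≤ n ∧ ∃ π : G, Nerode.mk f w = π • Nerode.mk f s)
    (hn : ¬ numOrbits (Nerode f) ≤ n) :
    ∃ S : Finset (List A), n < S.card ∧ (∀ s ∈ S, s.length ≤ n) ∧
      ∀ v ∈ S, ∀ w ∈ S, v ≠ w → ∀ π : G, Nerode.mk f v ≠ π • Nerode.mk f w := by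
  classical
  have hrep : ∀ o : orbitRel.Quotient G (Nerode f), ∃ s : List A, s.length ≤ n ∧
      Quotient.mk (orbitRel G (Nerode f)) (Nerode.mk f s) = o := by
    intro o
    obtain ⟨x, rfl⟩ := Quotient.mk_surjective (s := orbitRel G (Nerode f)) o
    obtain ⟨w, rfl⟩ := Nerode.mk_surjective f x
    obtain ⟨s, hs, π, hπ⟩ := hshort w
    exact ⟨s, hs, orbit_mk_eq_iff.2 ⟨π⁻¹, by rw [hπ, inv_smul_smul]⟩⟩
  choose s hs hso using hrep
  have hinj : Function.Injective s := fun o o' h => by rw [← hso o, h, hso]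
  obtain ⟨T, -, hT⟩ := Set.exists_subset_encard_eq
    (s := (Set.univ : Set (orbitRel.Quotient G (Nerode f)))) (k := (n + 1 : ℕ)) (by
      rw [Set.encard_univ]
      push_cast
      exact Order.add_one_le_of_lt (not_le.1 hn))
  have hTf : T.Finite := Set.finite_of_encard_eq_coe hT
  obtain ⟨T, rfl⟩ := hTf.exists_finset_coe
  rw [Set.encard_coe_eq_coe_finsetCard, Nat.cast_inj] at hT
  refine ⟨T.image s, by rw [Finset.card_image_of_injective _ hinj]; omega, ?_, ?_⟩
  · intro w hw
    obtain ⟨o, -, rfl⟩ := Finset.mem_image.1 hw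
    exact hs o
  · intro v hv w hw hne π heq
    obtain ⟨o, -, rfl⟩ := Finset.mem_image.1 hv
    obtain ⟨o', -, rfl⟩ := Finset.mem_image.1 hw
    refine hne (congrArg s ?_)
    rw [← hso o, ← hso o']
    exact orbit_mk_eq_iff.2 ⟨π, heq⟩

end Nerode

/-! ### Small sets of words refuting membership in the class -/

section Tests

lemma exists_family_of_small_subsets {α : Type*} (T : Finset α) (k : ℕ) :
    ∃ 𝓕 : Finset (Finset α), 𝓕.card ≤ (T.card + 1) ^ k ∧ ∀ R ⊆ T, R.card ≤ k → R ∈ 𝓕 := by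
  classical
  induction k with
  | zero =>
    refine ⟨{∅}, by simp, fun R _ hR => ?_⟩
    simpa using hR
  | succ k ih =>
    obtain ⟨𝓕, h𝓕, hmem⟩ := ih
    refine ⟨𝓕 ∪ (T ×ˢ 𝓕).image fun x => insert x.1 x.2, ?_, fun R hR hRk => ?_⟩
    · calc _ ≤ 𝓕.card + (T ×ˢ 𝓕).card :=
            (Finset.card_union_le _ _).trans (Nat.add_le_add_left Finset.card_image_le _)
        _ = (T.card + 1) * 𝓕.card := by rw [Finset.card_product]; ring
        _ ≤ (T.card + 1) * (T.card + 1) ^ k := Nat.mul_le_mul_left _ h𝓕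
        _ = _ := by ring
    · rcases R.eq_empty_or_nonempty with rfl | ⟨x, hx⟩
      · exact Finset.mem_union_left _ (hmem _ hR (by simp))
      · refine Finset.mem_union_right _ (Finset.mem_image.2 ⟨(x, R.erase x), ?_, ?_⟩)
        · refine Finset.mem_product.2 ⟨hR hx, hmem _ ((R.erase_subset x).trans hR) ?_⟩
          rw [Finset.card_erase_of_mem hx]
          omega
        · exact Finset.insert_erase hx

variable {A : Type u} [MulAction G A] (f : {f : List A → Bool // IsGLanguage f}) {n k : ℕ}

/-- By pigeonhole an automaton with `n` orbits sends some `v ≠ w` of `S` to states related by a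
permutation `π`. Only the restriction of `π` to the least support of the state of `w` matters; its
graph is a subset of `T ×ˢ T` with at most `k` elements. For every pair and every such graph, two
words separate `v` from a translate of `w` under `f`. -/
lemma exists_tests_of_many_orbits {S : Finset (List A)} (hS : n < S.card)
    (hSd : ∀ v ∈ S, ∀ w ∈ S, v ≠ w → ∀ π : G, Nerode.mk f v ≠ π • Nerode.mk f w)
    {T : Finset ℕ} (hT : ∀ s ∈ S, Supports G (T : Set ℕ) s) :
    ∃ Z : Finset (List A), Z.card ≤ S.card ^ 2 * (T.card ^ 2 + 1) ^ k * 2 ∧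
      ∀ C ∈ nominalLanguages A n k, ∃ x ∈ Z, C x ≠ f.1 x := by
  classical
  obtain ⟨𝓕, h𝓕, hmem⟩ := exists_family_of_small_subsets (T ×ˢ T) k
  have htest : ∀ x : (List A × List A) × Finset (ℕ × ℕ), ∃ Z : Finset (List A), Z.card ≤ 2 ∧
      (x.1.1 ∈ S → x.1.2 ∈ S → x.1.1 ≠ x.1.2 → (∃ π : G, ∀ y ∈ x.2, π y.1 = y.2) →
        ∃ (π : G) (e : List A), (∀ y ∈ x.2, π y.1 = y.2) ∧ x.1.1 ++ e ∈ Z ∧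
          π • x.1.2 ++ e ∈ Z ∧ f.1 (x.1.1 ++ e) ≠ f.1 (π • x.1.2 ++ e)) := by
    rintro ⟨⟨v, w⟩, R⟩
    by_cases h : v ∈ S ∧ w ∈ S ∧ v ≠ w ∧ ∃ π : G, ∀ y ∈ R, π y.1 = y.2
    · obtain ⟨hv, hw, hne, π, hπ⟩ := h
      have := hSd v hv w hw hne π
      rw [Nerode.smul_mk, Ne, Nerode.mk_eq_iff] at this
      push Not at this
      obtain ⟨e, he⟩ := this
      exact ⟨{v ++ e, π • w ++ e}, Finset.card_le_two, fun _ _ _ _ =>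
        ⟨π, e, hπ, by simp, by simp, he⟩⟩
    · exact ⟨∅, by simp, fun h1 h2 h3 h4 => absurd ⟨h1, h2, h3, h4⟩ h⟩
  choose Z hZc hZ using htest
  refine ⟨((S ×ˢ S) ×ˢ 𝓕).biUnion Z, ?_, ?_⟩
  · refine (Finset.card_biUnion_le_card_mul _ _ 2 fun x _ => hZc x).trans ?_
    rw [Finset.card_product, Finset.card_product, ← sq]
    rw [Finset.card_product, ← sq] at h𝓕
    gcongr
  · rintro C ⟨-, M, hMn, hMk, hM⟩
    by_contra! hagr
    have hfin : Finite (orbitRel.Quotient G M.Q) := M.orbitFinite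
    have := Fintype.ofFinite (orbitRel.Quotient G M.Q)
    obtain ⟨v, hv, w, hw, hne, hvw⟩ := Finset.exists_ne_map_eq_of_card_lt_of_maps_to
      (s := S) (t := (Finset.univ : Finset (orbitRel.Quotient G M.Q)))
      (f := fun s => Quotient.mk (orbitRel G M.Q) (M.toDFA.eval s)) (by
        refine lt_of_le_of_lt ?_ hS
        rwa [numOrbits, ENat.card_eq_coe_fintype_card, Nat.cast_le] at hMn)
      (fun _ _ => by simp)
    obtain ⟨π, hπ⟩ := orbit_mk_eq_iff.1 hvw
    obtain ⟨D, hD⟩ := M.nominal (M.toDFA.eval w)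
    have hDT : D ⊆ T := hD.subset (M.supports_eval (hT w hw))
    -- Pulling the support `T` of the state of `v` back along `π` supports the state of `w`, so it
    -- contains `D`.
    have hπDT : ∀ a ∈ D, π a ∈ T := by
      have h1 := supports_image (M.supports_eval (hT v hv)) π⁻¹
      rw [hπ, inv_smul_smul] at h1
      intro a ha
      obtain ⟨b, hb, rfl⟩ := Finset.mem_image.1 (hD.subset h1 ha)
      simpa using hb
    obtain ⟨ρ, e, hρ, h1, h2, h3⟩ := hZ ((v, w), D.image fun a => (a, π a)) hv hw hne
      ⟨π, by simp⟩
    have hR : ((v, w), D.image fun a => (a, π a)) ∈ (S ×ˢ S) ×ˢ 𝓕 := by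
      refine Finset.mem_product.2 ⟨Finset.mem_product.2 ⟨hv, hw⟩, hmem _ ?_ ?_⟩
      · intro y hy
        obtain ⟨a, ha, rfl⟩ := Finset.mem_image.1 hy
        exact Finset.mem_product.2 ⟨hDT ha, hπDT a ha⟩
      · exact Finset.card_image_le.trans (nominalDim_le_iff.1 hMk _ _ hD)
    refine h3 ?_
    -- The permutation `ρ` stored with the test may differ from `π`, but they agree on `D`.
    have h4 : M.toDFA.eval v = M.toDFA.eval (ρ • w) := by
      rw [M.eval_smul, hπ]
      refine smul_eq_smul_of_supports hD.1.1 fun a ha => ?_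
      exact (hρ (a, π a) (Finset.mem_image_of_mem _ ha)).symm
    rw [← hagr _ (Finset.mem_biUnion.2 ⟨_, hR, h1⟩), ← hagr _ (Finset.mem_biUnion.2 ⟨_, hR, h2⟩)]
    exact hM.append_congr h4 e

/-- An automaton in the class reaches by `s` a state with least support `R ⊆ T` of size at most `k`.
Such an `R` is too small to support the Nerode class of `s`, so some `π` fixing `R` changes this
class while the automaton cannot tell `s` from `π • s`. -/
lemma exists_tests_of_large_support {s : List A} {T : Finset ℕ} (hT : Supports G (T : Set ℕ) s)
    {E : Finset ℕ} (hE : IsLeastSupport E (Nerode.mk f s)) (hk : k < E.card) :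
    ∃ Z : Finset (List A), Z.card ≤ (T.card + 1) ^ k * 2 ∧
      ∀ C ∈ nominalLanguages A n k, ∃ x ∈ Z, C x ≠ f.1 x := by
  classical
  obtain ⟨𝓕, h𝓕, hmem⟩ := exists_family_of_small_subsets T k
  have htest : ∀ R : Finset ℕ, ∃ Z : Finset (List A), Z.card ≤ 2 ∧
      (R.card ≤ k → ∃ (π : G) (e : List A), (∀ a ∈ R, π a = a) ∧ s ++ e ∈ Z ∧
          π • s ++ e ∈ Z ∧ f.1 (s ++ e) ≠ f.1 (π • s ++ e)) := by
    intro R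
    by_cases hR : R.card ≤ k
    · have h : ¬ Supports G (R : Set ℕ) (Nerode.mk f s) := fun h =>
        absurd (Finset.card_le_card (hE.subset h)) (by omega)
      simp only [Supports, not_forall] at h
      obtain ⟨π, hπ, hne⟩ := h
      rw [Nerode.smul_mk, Nerode.mk_eq_iff] at hne
      push Not at hne
      obtain ⟨e, he⟩ := hne
      exact ⟨{s ++ e, π • s ++ e}, Finset.card_le_two, fun _ =>
        ⟨π, e, fun a ha => hπ ha, by simp, by simp, he.symm⟩⟩
    · exact ⟨∅, by simp, fun h => absurd h hR⟩
  choose Z hZc hZ using htest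
  refine ⟨𝓕.biUnion Z, ?_, ?_⟩
  · refine (Finset.card_biUnion_le_card_mul _ _ 2 fun x _ => hZc x).trans ?_
    gcongr
  · rintro C ⟨-, M, -, hMk, hM⟩
    by_contra! hagr
    obtain ⟨D, hD⟩ := M.nominal (M.toDFA.eval s)
    have hDk := nominalDim_le_iff.1 hMk _ _ hD
    have hDF : D ∈ 𝓕 := hmem D (hD.subset (M.supports_eval hT)) hDk
    obtain ⟨π, e, hπ, h1, h2, h3⟩ := hZ D hDk
    refine h3 ?_
    rw [← hagr _ (Finset.mem_biUnion.2 ⟨_, hDF, h1⟩), ← hagr _ (Finset.mem_biUnion.2 ⟨_, hDF, h2⟩)]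
    refine hM.append_congr ?_ e
    rw [M.eval_smul]
    exact (hD.1.1 π fun a ha => hπ a ha).symm

theorem exists_tests {p : ℕ}
    (hp : ∀ a : A, ∃ D : Finset ℕ, D.card ≤ p ∧ Supports G (D : Set ℕ) a)
    (g : List A → Bool) (hg : g ∉ nominalLanguages A n k) :
    ∃ Z : Finset (List A), Z.card ≤ (n + 1) ^ 2 * (((n + 1) * (n * p)) ^ 2 + 1) ^ k * 2 ∧
      ∀ C ∈ nominalLanguages A n k, ∃ x ∈ Z, C x ≠ g x := by
  classical
  by_cases hG : IsGLanguage g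
  swap
  · have hG' : ∃ (w : List A) (π : G), g (π • w) ≠ g w := by
      by_contra! h
      exact hG fun w hw π => (h w π).trans hw
    obtain ⟨w, π, hne⟩ := hG'
    refine ⟨{π • w, w}, Finset.card_le_two.trans (Nat.le_mul_of_pos_left _ (by positivity)), ?_⟩
    intro C hC
    by_contra! h
    have h1 := h (π • w) (by simp)
    have h2 := h w (by simp)
    rw [hC.1.smul_eq] at h1
    exact hne (h1.symm.trans h2)
  choose D hDc hD using fun w : List A => exists_supports_word hp w
  have hmany : ∀ S : Finset (List A), n < S.card → (∀ s ∈ S, s.length ≤ n) →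
      (∀ v ∈ S, ∀ w ∈ S, v ≠ w →
        ∀ π : G, Nerode.mk ⟨g, hG⟩ v ≠ π • Nerode.mk ⟨g, hG⟩ w) →
      ∃ Z : Finset (List A), Z.card ≤ (n + 1) ^ 2 * (((n + 1) * (n * p)) ^ 2 + 1) ^ k * 2 ∧
        ∀ C ∈ nominalLanguages A n k, ∃ x ∈ Z, C x ≠ g x := by
    intro S hS hSl hSd
    -- Cutting `S` down to exactly `n + 1` words makes the number of tests depend only on `n`, `k`
    -- and `p`.
    obtain ⟨S', hS', hSc⟩ := Finset.exists_subset_card_eq (Nat.succ_le_of_lt hS)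
    obtain ⟨Z, hZ, hZ'⟩ := exists_tests_of_many_orbits (k := k) ⟨g, hG⟩ (S := S') (n := n) (by omega)
      (fun v hv w hw => hSd v (hS' hv) w (hS' hw)) (T := S'.biUnion D)
      (fun s hs => (hD s).mono (Finset.coe_subset.2 (Finset.subset_biUnion_of_mem D hs)))
    refine ⟨Z, hZ.trans ?_, hZ'⟩
    have hT : (S'.biUnion D).card ≤ (n + 1) * (n * p) := by
      rw [← Nat.succ_eq_add_one, ← hSc]
      refine Finset.card_biUnion_le_card_mul _ _ _ fun s hs => (hDc s).trans ?_
      exact Nat.mul_le_mul_right p (hSl s (hS' hs))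
    rw [hSc]
    gcongr
  rcases exists_short_words ⟨g, hG⟩ n with hshort | ⟨S, hS, hSl, hSd⟩
  swap
  · exact hmany S hS hSl hSd
  by_cases hn : numOrbits (Nerode ⟨g, hG⟩) ≤ n
  swap
  · obtain ⟨S, hS, hSl, hSd⟩ := exists_short_words_of_lt_numOrbits ⟨g, hG⟩ hshort hn
    exact hmany S hS hSl hSd
  have hk : ¬ nominalDim (Nerode ⟨g, hG⟩) ≤ k := fun hk =>
    hg (mem_nominalLanguages_of_nerode ⟨g, hG⟩ (fun w => ⟨D w, hD w⟩) hn hk)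
  rw [nominalDim_le_iff] at hk
  push Not at hk
  obtain ⟨x, F, hF, hkF⟩ := hk
  obtain ⟨w, rfl⟩ := Nerode.mk_surjective _ x
  -- The offending state is moved within its orbit to that of a short word, which preserves the size
  -- of the support.
  obtain ⟨s, hs, π, hπ⟩ := hshort w
  obtain ⟨E, hE⟩ := exists_isLeastSupport (Nerode.supports_mk ⟨g, hG⟩ (hD s))
  have hFE : F.card ≤ E.card := by
    rw [hπ] at hF
    exact (Finset.card_le_card (hF.subset (supports_image hE.1.1 π))).trans Finset.card_image_le
  obtain ⟨Z, hZ, hZ'⟩ := exists_tests_of_large_support (n := n) ⟨g, hG⟩ (hD s) hE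
    (hkF.trans_le hFE)
  refine ⟨Z, hZ.trans (Nat.mul_le_mul_right 2 ?_), hZ'⟩
  have hT : (D s).card ≤ ((n + 1) * (n * p)) ^ 2 := by
    calc (D s).card ≤ n * p := (hDc s).trans (Nat.mul_le_mul_right p hs)
      _ ≤ (n + 1) * (n * p) := Nat.le_mul_of_pos_left _ (Nat.succ_pos n)
      _ ≤ _ := Nat.le_self_pow two_ne_zero _
  exact (Nat.pow_le_pow_left (Nat.succ_le_succ hT) k).trans
    (Nat.le_mul_of_pos_left _ (by positivity))

end Tests

/-! ### Counting the languages of the class -/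

section Counting

variable {A : Type u} [MulAction G A] {O : Type u}

/-- Finite descriptions of nominal automata with `n` orbits over an alphabet with orbit
representatives indexed by `O`: accepting orbits, initial orbit, and transitions between orbit
representatives, where permutations are recorded by their values on an initial segment. -/
abbrev AutomatonCode (O : Type u) (n k p : ℕ) : Type u :=
  (Fin n → Bool) × Fin n × (Fin n × O × (Fin p → Fin (k + p)) → Fin n × (Fin k → Fin (k + p)))

/-- The description `c` comes from an automaton recognizing `L`. -/
def IsCodeOf (r : O → A) {n k p : ℕ} (c : AutomatonCode O n k p) (L : List A → Bool) : Prop :=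
  ∃ (M : NominalDFA A) (q : Fin n → M.Q), M.Recognizes L ∧
    (∀ i, Supports G (Finset.range k : Set ℕ) (q i)) ∧
    (∀ i, q i ∈ M.toDFA.accept ↔ c.1 i = true) ∧ q c.2.1 = M.toDFA.start ∧
    ∀ x, ∀ ρ : G, (∀ l : Fin p, ρ l = x.2.2 l) →
      ∃ τ : G, (∀ l : Fin k, τ l = (c.2.2 x).2 l) ∧
        M.toDFA.step (q x.1) (ρ • r x.2.1) = τ • q (c.2.2 x).1

/-- A representative state uses only names below `k`. The at most `p` other names of a letter can be
renamed into `[k, k + p)` without affecting that state, so finitely many letters determine all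
transitions. -/
lemma exists_letter_normal_form {r : O → A} {p : ℕ}
    (hr : ∀ a, ∃ o, ∃ π : G, a = π • r o) (k : ℕ) (a : A) :
    ∃ (σ : G) (o : O) (t : Fin p → Fin (k + p)) (ρ : G), (∀ l ∈ Finset.range k, σ l = l) ∧
      (∀ l : Fin p, ρ l = t l) ∧ a = σ • ρ • r o := by
  obtain ⟨o, π, rfl⟩ := hr a
  obtain ⟨σ, hσ, hσ'⟩ := exists_perm_fixing_moving (Finset.range k) ((Finset.range p).image π)
    (Finset.Ico k (k + p)) (Finset.disjoint_left.2 fun y hy hy' => by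
      simp only [Finset.mem_Ico, Finset.mem_range] at hy hy'
      omega)
    ((Finset.card_le_card Finset.sdiff_subset).trans (Finset.card_image_le.trans (by simp)))
  have hlt : ∀ l : Fin p, (σ * π) l < k + p := fun l => by
    rw [Equiv.Perm.mul_apply]
    by_cases h : π l ∈ Finset.range k
    · rw [hσ _ h]
      have := Finset.mem_range.1 h
      omega
    · exact (Finset.mem_Ico.1 (hσ' _
        (Finset.mem_image_of_mem _ (Finset.mem_range.2 l.2)) h)).2
  refine ⟨σ⁻¹, o, fun l => ⟨(σ * π) l, hlt l⟩, σ * π, fun l hl => ?_, fun l => rfl, ?_⟩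
  · conv_lhs => rw [← hσ l hl]
    exact σ.symm_apply_apply l
  · rw [smul_smul, inv_mul_cancel_left]

/-- Two automata with the same code stay synchronized: from `π • q i` and `π • q' i` every letter
leads to states of this form again, with a common index and a common permutation. -/
lemma IsCodeOf.unique {r : O → A} {n k p : ℕ} (hr : ∀ a, ∃ o, ∃ π : G, a = π • r o)
    {c : AutomatonCode O n k p} {L L' : List A → Bool} (h : IsCodeOf r c L)
    (h' : IsCodeOf r c L') : L = L' := by
  obtain ⟨M, q, hM, hq, hacc, hstart, hstep⟩ := h
  obtain ⟨M', q', hM', hq', hacc', hstart', hstep'⟩ := h'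
  have key : ∀ (w : List A) (i : Fin n) (π : G),
      M.toDFA.evalFrom (π • q i) w ∈ M.toDFA.accept ↔
        M'.toDFA.evalFrom (π • q' i) w ∈ M'.toDFA.accept := by
    intro w
    induction w with
    | nil =>
      intro i π
      simp only [DFA.evalFrom_nil, NominalDFA.smul_mem_accept, hacc, hacc']
    | cons a w ih =>
      intro i π
      obtain ⟨σ, o, t, ρ, hσ, hρ, ha⟩ := exists_letter_normal_form hr k (π⁻¹ • a)
      obtain ⟨τ, hτ, hs⟩ := hstep (i, o, t) ρ hρ
      obtain ⟨τ', hτ', hs'⟩ := hstep' (i, o, t) ρ hρ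
      have ha' : a = (π * σ) • ρ • r o := by rw [mul_smul, ← ha, smul_inv_smul]
      have h1 : M.toDFA.step (π • q i) a = (π * σ * τ) • q (c.2.2 (i, o, t)).1 := by
        rw [mul_smul, ← hs, ← M.step_equivariant, ← ha', mul_smul, hq i σ fun l hl => hσ l hl]
      have h2 : M'.toDFA.step (π • q' i) a = (π * σ * τ) • q' (c.2.2 (i, o, t)).1 := by
        -- The code fixes `τ` and `τ'` only below `k`, which is enough because those names support
        -- `q'`.
        have hττ' : τ • q' (c.2.2 (i, o, t)).1 = τ' • q' (c.2.2 (i, o, t)).1 :=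
          smul_eq_smul_of_supports (hq' _) fun l hl =>
            (hτ ⟨l, Finset.mem_range.1 hl⟩).trans (hτ' ⟨l, Finset.mem_range.1 hl⟩).symm
        rw [mul_smul, hττ', ← hs', ← M'.step_equivariant, ← ha', mul_smul,
          hq' i σ fun l hl => hσ l hl]
      rw [DFA.evalFrom_cons, DFA.evalFrom_cons, h1, h2]
      exact ih _ _
  funext w
  rw [Bool.eq_iff_iff, ← hM, ← hM', DFA.mem_accepts, DFA.mem_accepts, DFA.eval, DFA.eval,
    ← hstart, ← hstart']
  simpa using key w c.2.1 1

lemma exists_state_representatives (M : NominalDFA A) {n k : ℕ} (hn : numOrbits M.Q ≤ n)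
    (hk : nominalDim M.Q ≤ k) :
    ∃ q : Fin n → M.Q, (∀ i, Supports G (Finset.range k : Set ℕ) (q i)) ∧
      ∀ x, ∃ i, ∃ π : G, x = π • q i := by
  have hfin : Finite (orbitRel.Quotient G M.Q) := M.orbitFinite
  have := Fintype.ofFinite (orbitRel.Quotient G M.Q)
  rw [numOrbits, ENat.card_eq_coe_fintype_card, Nat.cast_le] at hn
  have hne : Nonempty (orbitRel.Quotient G M.Q) := ⟨Quotient.mk _ M.toDFA.start⟩
  -- With fewer than `n` orbits, the inverse of this embedding repeats some representatives, which
  -- is harmless.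
  obtain ⟨e⟩ : Nonempty (orbitRel.Quotient G M.Q ↪ Fin n) :=
    Function.Embedding.nonempty_of_card_le (by simpa using hn)
  have hsurj := Function.invFun_surjective e.injective
  have hrep : ∀ o : orbitRel.Quotient G M.Q, ∃ x : M.Q, Quotient.mk (orbitRel G M.Q) x = o ∧
      Supports G (Finset.range k : Set ℕ) x := by
    intro o
    obtain ⟨x, rfl⟩ := Quotient.mk_surjective (s := orbitRel G M.Q) o
    obtain ⟨D, hD⟩ := M.nominal x
    obtain ⟨π, hπ⟩ := exists_smul_supports_range hD.1.1 (nominalDim_le_iff.1 hk x D hD)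
    exact ⟨π • x, orbit_mk_eq_iff.2 ⟨π, rfl⟩, hπ⟩
  choose q hqo hq using hrep
  refine ⟨fun i => q (Function.invFun e i), fun i => hq _, fun x => ?_⟩
  obtain ⟨i, hi⟩ := hsurj (Quotient.mk (orbitRel G M.Q) x)
  exact ⟨i, orbit_mk_eq_iff.1 (by rw [hqo, hi])⟩

/-- A permutation relating two elements with bounded supports may be chosen with bounded values. -/
lemma exists_smul_eq_of_supports_range {X : Type u} [MulAction G X] {x y : X} {k m : ℕ} (hkm : k ≤ m)
    (hx : Supports G (Finset.range k : Set ℕ) x) (hy : Supports G (Finset.range m : Set ℕ) y)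
    {π : G} (hπ : y = π • x) :
    ∃ τ : G, (∀ l < k, τ l < m) ∧ y = τ • x := by
  classical
  obtain ⟨D, hD⟩ := exists_isLeastSupport hx
  have hDk : D ⊆ Finset.range k := hD.subset hx
  have hDm : D.image π ⊆ Finset.range m := by
    have h1 := supports_image hy π⁻¹
    rw [hπ, inv_smul_smul] at h1
    intro b hb
    obtain ⟨a, ha, rfl⟩ := Finset.mem_image.1 hb
    obtain ⟨b', hb', rfl⟩ := Finset.mem_image.1 (hD.subset h1 ha)
    simpa using hb'
  -- Values of `π` on the least support are kept; the other `k - |D|` values go to the `m - |D|`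
  -- unused names below `m`.
  obtain ⟨σ, hσ, hσ'⟩ := exists_perm_fixing_moving (D.image π) ((Finset.range k).image π)
    (Finset.range m \ D.image π) Finset.sdiff_disjoint (by
      rw [Finset.card_sdiff_of_subset (Finset.image_subset_image hDk),
        Finset.card_sdiff_of_subset hDm, Finset.card_image_of_injective _ π.injective,
        Finset.card_range, Finset.card_range]
      omega)
  refine ⟨σ * π, fun l hl => ?_, ?_⟩
  · rw [Equiv.Perm.mul_apply]
    by_cases h : π l ∈ D.image π
    · rw [hσ _ h]
      exact Finset.mem_range.1 (hDm h)
    · exact Finset.mem_range.1 (Finset.mem_sdiff.1 (hσ' _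
        (Finset.mem_image_of_mem _ (Finset.mem_range.2 hl)) h)).1
  · rw [hπ]
    refine smul_eq_smul_of_supports hD.1.1 fun a ha => ?_
    rw [Equiv.Perm.mul_apply, hσ _ (Finset.mem_image_of_mem _ ha)]

lemma exists_isCodeOf {r : O → A} {n k p : ℕ} (hk : 1 ≤ k)
    (hrs : ∀ o, Supports G (Finset.range p : Set ℕ) (r o)) {L : List A → Bool}
    (hL : L ∈ nominalLanguages A n k) :
    ∃ c : AutomatonCode O n k p, IsCodeOf r c L := by
  classical
  obtain ⟨-, M, hMn, hMk, hM⟩ := hL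
  obtain ⟨q, hq, hqs⟩ := exists_state_representatives M hMn hMk
  obtain ⟨i₀, π₀, h₀⟩ := hqs M.toDFA.start
  -- The initial state is fixed by the group, so it is its own orbit's representative.
  have hstart : q i₀ = M.toDFA.start := by
    rw [← M.smul_start π₀⁻¹, h₀, inv_smul_smul]
  have htrans : ∀ x : Fin n × O × (Fin p → Fin (k + p)), ∃ y : Fin n × (Fin k → Fin (k + p)),
      ∀ ρ : G, (∀ l : Fin p, ρ l = x.2.2 l) → ∃ τ : G, (∀ l : Fin k, τ l = y.2 l) ∧
        M.toDFA.step (q x.1) (ρ • r x.2.1) = τ • q y.1 := by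
    rintro ⟨i, o, t⟩
    by_cases h : ∃ ρ : G, ∀ l : Fin p, ρ l = t l
    · obtain ⟨ρ, hρ⟩ := h
      obtain ⟨j, π, hπ⟩ := hqs (M.toDFA.step (q i) (ρ • r o))
      obtain ⟨τ, hτ, hs⟩ := exists_smul_eq_of_supports_range (Nat.le_add_right k p) (hq j) (by
        intro σ hσ
        have h1 : σ • ρ • r o = ρ • r o := by
          rw [smul_smul]
          refine smul_eq_smul_of_supports (hrs o) fun l hl => ?_
          have hl' : l < p := Finset.mem_range.1 hl
          have := hρ ⟨l, hl'⟩
          refine hσ ?_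
          rw [show ρ l = t ⟨l, hl'⟩ from this]
          exact Finset.mem_coe.2 (Finset.mem_range.2 (t ⟨l, hl'⟩).2)
        have h2 : σ • q i = q i := hq i σ fun l hl => by
          have := Finset.mem_range.1 (Finset.mem_coe.1 hl)
          exact hσ (Finset.mem_coe.2 (Finset.mem_range.2 (by omega)))
        rw [← M.step_equivariant, h1, h2]) hπ
      refine ⟨(j, fun l => ⟨τ l, hτ l l.2⟩), fun ρ' hρ' => ⟨τ, fun l => rfl, ?_⟩⟩
      rw [← hs]
      congr 1
      refine smul_eq_smul_of_supports (hrs o) fun l hl => ?_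
      have hl' : l < p := Finset.mem_range.1 hl
      exact (hρ' ⟨l, hl'⟩).trans (hρ ⟨l, hl'⟩).symm
    -- If `t` extends to no permutation, the requirement is vacuous and the entry arbitrary.
    · exact ⟨(i, fun _ => ⟨0, by omega⟩), fun ρ hρ => absurd ⟨ρ, hρ⟩ h⟩
  choose y hy using htrans
  exact ⟨(fun i => decide (q i ∈ M.toDFA.accept), i₀, y), M, q, hM, hq, by simp, hstart, hy⟩

theorem finite_nominalLanguages_and_ncard_lt [Fintype O] {r : O → A} {n k p : ℕ} (hk : 1 ≤ k)
    (hrs : ∀ o, Supports G (Finset.range p : Set ℕ) (r o))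
    (hr : ∀ a, ∃ o, ∃ π : G, a = π • r o) :
    (nominalLanguages A n k).Finite ∧ (nominalLanguages A n k).ncard <
      2 ^ (2 * n + n * (k + p) ^ k * (n * (Fintype.card O * (k + p) ^ p)) + 1) := by
  classical
  have hcode : ∀ L : nominalLanguages A n k, ∃ c : AutomatonCode O n k p, IsCodeOf r c L.1 :=
    fun L => exists_isCodeOf hk hrs L.2
  choose c hc using hcode
  have hinj : Function.Injective c := fun L L' h =>
    Subtype.ext ((hc L).unique hr (h ▸ hc L'))
  have hfin : Finite (nominalLanguages A n k) := Finite.of_injective c hinj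
  refine ⟨hfin, ?_⟩
  have hcard : (nominalLanguages A n k).ncard ≤
      2 ^ n * (n * (n * (k + p) ^ k) ^ (n * (Fintype.card O * (k + p) ^ p))) := by
    rw [← Nat.card_coe_set_eq]
    refine (Nat.card_le_card_of_injective c hinj).trans_eq ?_
    simp [Nat.card_eq_fintype_card]
  refine hcard.trans_lt ?_
  calc 2 ^ n * (n * (n * (k + p) ^ k) ^ (n * (Fintype.card O * (k + p) ^ p)))
      -- The crude bound `x ≤ 2 ^ x` suffices, since `(k + p) ^ k` may appear in the exponent `d`.
      ≤ 2 ^ n * (2 ^ n * (2 ^ (n * (k + p) ^ k)) ^ (n * (Fintype.card O * (k + p) ^ p))) := by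
        gcongr <;> exact Nat.lt_two_pow_self.le
    _ = 2 ^ (2 * n + n * (k + p) ^ k * (n * (Fintype.card O * (k + p) ^ p))) := by
        rw [← pow_mul, ← pow_add, ← pow_add]
        congr 1
        ring
    _ < _ := Nat.pow_lt_pow_right one_lt_two (Nat.lt_succ_self _)

end Counting

/-! ### The arithmetic of the bound -/

lemma tests_mul_log_count_le (p o c : ℕ) : ∃ K : ℕ, ∀ n k : ℕ, 2 ≤ n → 1 ≤ k → k ≤ n ^ c →
    (n + 1) ^ 2 * (((n + 1) * (n * p)) ^ 2 + 1) ^ k * 2 *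
      (2 * n + n * (k + p) ^ k * (n * (o * (k + p) ^ p)) + 1) * k ^ k ≤ n ^ (K * k) := by
  obtain ⟨b, hb⟩ : ∃ b, b = p + o := ⟨_, rfl⟩
  obtain ⟨s, hs⟩ : ∃ s, s = c + b + 1 := ⟨_, rfl⟩
  -- The three summands pay for the tests, for the logarithm of the number of languages, and for `k
  -- ^ k ≤ n ^ (c * k)`. Here `s` is chosen so that `k + p ≤ n ^ s`.
  refine ⟨(2 * b + 12) + (4 + b + s + s * p) + c, fun n k hn hk hkc => ?_⟩
  have h1n : 1 ≤ n := by omega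
  have hmono : ∀ {i j : ℕ}, i ≤ j → n ^ i ≤ n ^ j := fun h => Nat.pow_le_pow_right h1n h
  have hlt : ∀ x ≤ b, x ≤ n ^ b := fun x hx =>
    (hx.trans Nat.lt_two_pow_self.le).trans (Nat.pow_le_pow_left hn b)
  have hp : p ≤ n ^ b := hlt p (by omega)
  have ho : o ≤ n ^ b := hlt o (by omega)
  have hn1 : n + 1 ≤ n ^ 2 := by nlinarith
  have hm : (n + 1) ^ 2 * (((n + 1) * (n * p)) ^ 2 + 1) ^ k * 2 ≤ n ^ ((2 * b + 12) * k) := by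
    have h1 : ((n + 1) * (n * p)) ^ 2 + 1 ≤ n ^ (2 * b + 7) := by
      calc ((n + 1) * (n * p)) ^ 2 + 1 ≤ (n ^ 2 * (n * n ^ b)) ^ 2 + n ^ (2 * b + 6) := by
            gcongr
            exact Nat.one_le_pow _ _ h1n
        _ = 2 * n ^ (2 * b + 6) := by ring
        _ ≤ n * n ^ (2 * b + 6) := by gcongr
        _ = _ := by ring
    calc (n + 1) ^ 2 * (((n + 1) * (n * p)) ^ 2 + 1) ^ k * 2
        ≤ (n ^ 2) ^ 2 * (n ^ (2 * b + 7)) ^ k * n := by gcongr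
      _ = n ^ (5 + (2 * b + 7) * k) := by ring
      _ ≤ _ := hmono (by nlinarith)
  have hkp : k + p ≤ n ^ s := by
    calc k + p ≤ n ^ (c + b) + n ^ (c + b) :=
          Nat.add_le_add (hkc.trans (hmono (by omega))) (hp.trans (hmono (by omega)))
      _ = 2 * n ^ (c + b) := by ring
      _ ≤ n * n ^ (c + b) := by gcongr
      _ = _ := by rw [hs]; ring
  have hd : 2 * n + n * (k + p) ^ k * (n * (o * (k + p) ^ p)) + 1 ≤
      n ^ ((4 + b + s + s * p) * k) := by
    have h1 : n * (k + p) ^ k * (n * (o * (k + p) ^ p)) ≤ n ^ (2 + b + s * k + s * p) := by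
      calc n * (k + p) ^ k * (n * (o * (k + p) ^ p))
          ≤ n * (n ^ s) ^ k * (n * (n ^ b * (n ^ s) ^ p)) := by gcongr
        _ = _ := by ring
    have h2 : n ^ 2 ≤ n ^ (2 + b + s * k + s * p) := hmono (by omega)
    have h3 : 2 * n ≤ n ^ 2 := by nlinarith
    calc 2 * n + n * (k + p) ^ k * (n * (o * (k + p) ^ p)) + 1
        ≤ 4 * n ^ (2 + b + s * k + s * p) := by omega
      _ ≤ n ^ 2 * n ^ (2 + b + s * k + s * p) := by
          gcongr
          nlinarith
      _ = n ^ (4 + b + s * k + s * p) := by ring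
      _ ≤ _ := hmono (by nlinarith [Nat.zero_le (b * (k - 1)), Nat.mul_le_mul_left b hk,
          Nat.mul_le_mul_left (s * p) hk])
  calc _ ≤ n ^ ((2 * b + 12) * k) * n ^ ((4 + b + s + s * p) * k) * (n ^ c) ^ k := by gcongr
    _ = _ := by ring

end NominalLearning

theorem mainTheorem2 {A : Type*} [MulAction NominalLearning.G A]
    (hA : NominalLearning.IsNominal A) (hfin : NominalLearning.OrbitFinite A) (c : ℕ) :
    ∃ C : ℕ, ∀ n k : ℕ, 2 ≤ n → 1 ≤ k → k ≤ n ^ c →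
      (NominalLearning.queryComplexity (NominalLearning.nominalLanguages A n k)
          (NominalLearning.nominalLanguages A n k) : ENNReal) ≤
        (n : ENNReal) ^ (C * k) / (k : ENNReal) ^ k := by
  classical
  obtain ⟨p, r, hrs, hr⟩ := NominalLearning.exists_orbit_representatives hA hfin
  have : Finite (MulAction.orbitRel.Quotient NominalLearning.G A) := hfin
  have := Fintype.ofFinite (MulAction.orbitRel.Quotient NominalLearning.G A)
  have hp : ∀ a : A, ∃ D : Finset ℕ, D.card ≤ p ∧
      MulAction.Supports NominalLearning.G (D : Set ℕ) a := by
    intro a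
    obtain ⟨o, π, rfl⟩ := hr a
    exact ⟨_, Finset.card_image_le.trans_eq (Finset.card_range p),
      NominalLearning.supports_image (hrs o) π⟩
  obtain ⟨K, hK⟩ := NominalLearning.tests_mul_log_count_le p
    (Fintype.card (MulAction.orbitRel.Quotient NominalLearning.G A)) c
  refine ⟨K, fun n k hn hk hkc => ?_⟩
  obtain ⟨hfinite, hcard⟩ :=
    NominalLearning.finite_nominalLanguages_and_ncard_lt (n := n) hk hrs hr
  have hq := NominalLearning.queryComplexity_le_of_tests hfinite
    (Nat.succ_le_of_lt (by positivity)) hcard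
    (fun f hf => NominalLearning.exists_tests hp f hf)
  have hk0 : (k : ENNReal) ^ k ≠ 0 := pow_ne_zero _ (by simp; omega)
  have hktop : (k : ENNReal) ^ k ≠ ⊤ := ENNReal.pow_ne_top (ENNReal.natCast_ne_top k)
  -- Clearing the denominator reduces the claim to an inequality of natural numbers.
  rw [ENNReal.le_div_iff_mul_le (Or.inl hk0) (Or.inl hktop)]
  refine (mul_le_mul_left (ENat.toENNReal_le.2 hq) _).trans ?_
  rw [ENat.toENNReal_coe]
  exact_mod_cast hK n k hn hk hkc
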